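/- Fix a first-order language with arbitrary relation and function symbols (of all arities, including $0$) and countably many parameters (free variables). Formulas are built from atomic formulas $P$ and $\bot$ (which is not counted as atomic) by $\wedge,\vee,\to,\forall,\exists$ and are identified up to renaming of bound variables. A sequent $\Gamma\Rightarrow\Delta$ is a pair of finite multisets of formulas. The classical calculus $\mathbf{G3c}$ has the initial sequents $P,\Gamma\Rightarrow\Delta,P$ ($P$ atomic), the initial sequents $\bot,\Gamma\Rightarrow\Delta$ (the rule $L\bot$), and the rules (premisses / conclusion) - $L\wedge$: $A,B,\Gamma\Rightarrow\Delta\ /\ A\wedge B,\Gamma\Rightarrow\Delta$; $R\wedge$: $\Gamma\Rightarrow\Delta,A$ and $\Gamma\Rightarrow\Delta,B\ /\ \Gamma\Rightarrow\Delta,A\wedge B$; - $L\vee$: $A,\Gamma\Rightarrow\Delta$ and $B,\Gamma\Rightarrow\Delta\ /\ A\vee B,\Gamma\Rightarrow\Delta$; $R\vee$: $\Gamma\Rightarrow\Delta,A,B\ /\ \Gamma\Rightarrow\Delta,A\vee B$; - $L{\to}$: $\Gamma\Rightarrow\Delta,A$ and $B,\Gamma\Rightarrow\Delta\ /\ A\to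 B,\Gamma\Rightarrow\Delta$; $R{\to}$: $A,\Gamma\Rightarrow\Delta,B\ /\ \Gamma\Rightarrow\Delta,A\to B$; - $L\forall$: $A[x/t],\forall xA,\Gamma\Rightarrow\Delta\ /\ \forall xA,\Gamma\Rightarrow\Delta$; $R\forall$: $\Gamma\Rightarrow\Delta,A[x/a]\ /\ \Gamma\Rightarrow\Delta,\forall xA$; - $L\exists$: $A[x/a],\Gamma\Rightarrow\Delta\ /\ \exists xA,\Gamma\Rightarrow\Delta$; $R\exists$: $\Gamma\Rightarrow\Delta,\exists xA,A[x/t]\ /\ \Gamma\Rightarrow\Delta,\exists xA$, where $t$ is any term and the parameter $a$ does not occur in the conclusion of $R\forall$, $L\exists$. The intuitionistic calculus $\mathbf{G3i}$ is obtained from $\mathbf{G3c}$ by replacing $L{\to}$, $R{\to}$, $R\forall$ by - $L^i{\to}$: $A\to B,\Gamma\Rightarrow\Delta,A$ and $B,\Gamma\Rightarrow\Delta\ /\ A\to B,\Gamma\Rightarrow\Delta$; $R^i{\to}$: $A,\Gamma\Rightarrow B\ /\ \Gamma\Rightarrow\Delta,A\to B$; - $R^i\forall$: $\Gamma\Rightarrow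 A[x/a]\ /\ \Gamma\Rightarrow\Delta,\forall xA$ ($a$ not occurring in the conclusion). The minimal calculus $\mathbf{G3m}$ is obtained from $\mathbf{G3i}$ by replacing $L\bot$ by the initial sequents $\bot,\Gamma\Rightarrow\Delta,\bot$. The structural rules are - weakening: $\Gamma\Rightarrow\Delta\ /\ A,\Gamma\Rightarrow\Delta$ and $\Gamma\Rightarrow\Delta\ /\ \Gamma\Rightarrow\Delta,A$; - contraction: $A,A,\Gamma\Rightarrow\Delta\ /\ A,\Gamma\Rightarrow\Delta$ and $\Gamma\Rightarrow\Delta,A,A\ /\ \Gamma\Rightarrow\Delta,A$; - cut: $\Gamma\Rightarrow\Delta,A$ and $A,\Lambda\Rightarrow\Theta\ /\ \Gamma,\Lambda\Rightarrow\Delta,\Theta$, and context-sharing cut: $\Gamma\Rightarrow\Delta,A$ and $A,\Gamma\Rightarrow\Delta\ /\ \Gamma\Rightarrow\Delta$. **Corollary.** Each of these structural rules is admissible in each of $\mathbf{G3m}$, $\mathbf{G3i}$ and $\mathbf{G3c}$: for every instance of the rule, if its premisses are derivable in the calculus, then so is its conclusion. Consequently every sequent derivable in one of these calculi extended by all the structural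 rules is already derivable in the calculus itself. -/

import Mathlib

namespace G3

universe u v

/-- First-order formulas over the language `L`, up to renaming of bound variables.  The free
variables (parameters) are the natural numbers; a formula of type `Fml L n` may in addition contain
the `n` dangling bound variables `Fin n`, and a quantifier binds the variable `0 : Fin (n + 1)` of
its scope.  The formulas of the calculus are those of type `Fml L 0`.  Negation `¬ A` is `A → ⊥`. -/
inductive Fml (L : FirstOrder.Language.{u, v}) : ℕ → Type (max u v)
  | rel {n k : ℕ} (R : L.Relations k) (ts : Fin k → L.Term (ℕ ⊕ Fin n)) : Fml L n
  | bot {n : ℕ} : Fml L n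
  | and {n : ℕ} (A B : Fml L n) : Fml L n
  | or {n : ℕ} (A B : Fml L n) : Fml L n
  | imp {n : ℕ} (A B : Fml L n) : Fml L n
  | all {n : ℕ} (A : Fml L (n + 1)) : Fml L n
  | ex {n : ℕ} (A : Fml L (n + 1)) : Fml L n

variable {L : FirstOrder.Language.{u, v}}

/-- A substitution carried under a quantifier. -/
def liftSubst {n m : ℕ} (σ : ℕ ⊕ Fin n → L.Term (ℕ ⊕ Fin m)) :
    ℕ ⊕ Fin (n + 1) → L.Term (ℕ ⊕ Fin (m + 1)) :=
  Sum.elim (fun a => (σ (Sum.inl a)).relabel (Sum.map id Fin.succ))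
    (Fin.cases (FirstOrder.Language.Term.var (Sum.inr 0))
      (fun i => (σ (Sum.inr i)).relabel (Sum.map id Fin.succ)))

namespace Fml

/-- Simultaneous capture-avoiding substitution of terms for parameters and dangling variables. -/
def subst : {n m : ℕ} → Fml L n → (ℕ ⊕ Fin n → L.Term (ℕ ⊕ Fin m)) → Fml L m
  | _, _, rel R ts, σ => rel R (fun i => (ts i).subst σ)
  | _, _, bot, _ => bot
  | _, _, and A B, σ => and (A.subst σ) (B.subst σ)
  | _, _, or A B, σ => or (A.subst σ) (B.subst σ)
  | _, _, imp A B, σ => imp (A.subst σ) (B.subst σ)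
  | _, _, all A, σ => all (A.subst (liftSubst σ))
  | _, _, ex A, σ => ex (A.subst (liftSubst σ))

/-- `A.inst t` is `A[x/t]`, where `x` is the only dangling bound variable of `A`. -/
def inst (A : Fml L 1) (t : L.Term (ℕ ⊕ Fin 0)) : Fml L 0 :=
  A.subst (Sum.elim (fun a => FirstOrder.Language.Term.var (Sum.inl a)) (fun _ => t))

/-- The parameter `a` occurs in the formula. -/
def Occurs (a : ℕ) : {n : ℕ} → Fml L n → Prop
  | _, rel _ ts => ∃ i, Sum.inl a ∈ (ts i).varFinset
  | _, bot => False
  | _, and A B => A.Occurs a ∨ B.Occurs a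
  | _, or A B => A.Occurs a ∨ B.Occurs a
  | _, imp A B => A.Occurs a ∨ B.Occurs a
  | _, all A => A.Occurs a
  | _, ex A => A.Occurs a

end Fml

/-- The parameter `a`, regarded as a term. -/
def param (a : ℕ) : L.Term (ℕ ⊕ Fin 0) := FirstOrder.Language.Term.var (Sum.inl a)

variable (L) in
/-- A sequent `Γ ⇒ Δ`: a pair of finite multisets of formulas. -/
@[ext]
structure Sequent where
  /-- the antecedent `Γ` -/
  ant : Multiset (Fml L 0)
  /-- the succedent `Δ` -/
  suc : Multiset (Fml L 0)

/-- The parameter `a` does not occur in the sequent. -/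
def Sequent.Fresh (a : ℕ) (s : Sequent L) : Prop :=
  (∀ A ∈ s.ant, ¬ A.Occurs a) ∧ (∀ A ∈ s.suc, ¬ A.Occurs a)

variable (L) in
/-- A rule, given by its instances: `r ps s` says that the list of premisses `ps` and the
conclusion `s` form an instance of `r`.  A calculus is given in the same way, by the instances of
all of its rules, where initial sequents are instances without premisses. -/
abbrev Rule := List (Sequent L) → Sequent L → Prop

/-- `Derivable C s`: there is a derivation of the sequent `s` in the calculus `C`. -/
inductive Derivable (C : Rule L) : Sequent L → Prop
  | infer (ps : List (Sequent L)) (s : Sequent L) (h : C ps s)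
      (hps : ∀ p ∈ ps, Derivable C p) : Derivable C s

/-- The rule `r` is admissible in the calculus `C`: in each of its instances, if the premisses are
derivable in `C`, then so is the conclusion. -/
def Admissible (r C : Rule L) : Prop :=
  ∀ ps s, r ps s → (∀ p ∈ ps, Derivable C p) → Derivable C s

/-- The three systems: minimal, intuitionistic and classical. -/
inductive System
  | m
  | i
  | c

/-- The initial sequents and the logical rules of the multisuccedent calculi
`G3m`, `G3i` and `G3c`. -/
inductive Calc (L : FirstOrder.Language.{u, v}) : System → Rule L
  | init {X : System} {k : ℕ} (R : L.Relations k) (ts : Fin k → L.Term (ℕ ⊕ Fin 0))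
      (Γ Δ : Multiset (Fml L 0)) :
      Calc L X [] ⟨Fml.rel R ts ::ₘ Γ, Fml.rel R ts ::ₘ Δ⟩
  -- the initial sequents with `⊥` on both sides, in the minimal system
  | botInit (Γ Δ : Multiset (Fml L 0)) :
      Calc L .m [] ⟨Fml.bot ::ₘ Γ, Fml.bot ::ₘ Δ⟩
  -- the left rule for `⊥`, in the intuitionistic and the classical system
  | botL {X : System} (hX : X ≠ .m) (Γ Δ : Multiset (Fml L 0)) :
      Calc L X [] ⟨Fml.bot ::ₘ Γ, Δ⟩
  | andL {X : System} (A B : Fml L 0) (Γ Δ : Multiset (Fml L 0)) :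
      Calc L X [⟨A ::ₘ B ::ₘ Γ, Δ⟩] ⟨Fml.and A B ::ₘ Γ, Δ⟩
  | andR {X : System} (A B : Fml L 0) (Γ Δ : Multiset (Fml L 0)) :
      Calc L X [⟨Γ, A ::ₘ Δ⟩, ⟨Γ, B ::ₘ Δ⟩] ⟨Γ, Fml.and A B ::ₘ Δ⟩
  | orL {X : System} (A B : Fml L 0) (Γ Δ : Multiset (Fml L 0)) :
      Calc L X [⟨A ::ₘ Γ, Δ⟩, ⟨B ::ₘ Γ, Δ⟩] ⟨Fml.or A B ::ₘ Γ, Δ⟩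
  | orR {X : System} (A B : Fml L 0) (Γ Δ : Multiset (Fml L 0)) :
      Calc L X [⟨Γ, A ::ₘ B ::ₘ Δ⟩] ⟨Γ, Fml.or A B ::ₘ Δ⟩
  -- classical rules for implication
  | impLc (A B : Fml L 0) (Γ Δ : Multiset (Fml L 0)) :
      Calc L .c [⟨Γ, A ::ₘ Δ⟩, ⟨B ::ₘ Γ, Δ⟩] ⟨Fml.imp A B ::ₘ Γ, Δ⟩
  | impRc (A B : Fml L 0) (Γ Δ : Multiset (Fml L 0)) :
      Calc L .c [⟨A ::ₘ Γ, B ::ₘ Δ⟩] ⟨Γ, Fml.imp A B ::ₘ Δ⟩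
  -- minimal and intuitionistic rules for implication
  | impLi {X : System} (hX : X ≠ .c) (A B : Fml L 0) (Γ Δ : Multiset (Fml L 0)) :
      Calc L X [⟨Fml.imp A B ::ₘ Γ, A ::ₘ Δ⟩, ⟨B ::ₘ Γ, Δ⟩] ⟨Fml.imp A B ::ₘ Γ, Δ⟩
  | impRi {X : System} (hX : X ≠ .c) (A B : Fml L 0) (Γ Δ : Multiset (Fml L 0)) :
      Calc L X [⟨A ::ₘ Γ, {B}⟩] ⟨Γ, Fml.imp A B ::ₘ Δ⟩
  | allL {X : System} (A : Fml L 1) (t : L.Term (ℕ ⊕ Fin 0)) (Γ Δ : Multiset (Fml L 0)) :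
      Calc L X [⟨A.inst t ::ₘ Fml.all A ::ₘ Γ, Δ⟩] ⟨Fml.all A ::ₘ Γ, Δ⟩
  -- the classical right rule for the universal quantifier
  | allRc (A : Fml L 1) (a : ℕ) (Γ Δ : Multiset (Fml L 0))
      (ha : Sequent.Fresh a ⟨Γ, Fml.all A ::ₘ Δ⟩) :
      Calc L .c [⟨Γ, A.inst (param a) ::ₘ Δ⟩] ⟨Γ, Fml.all A ::ₘ Δ⟩
  -- the minimal and intuitionistic right rule for the universal quantifier
  | allRi {X : System} (hX : X ≠ .c) (A : Fml L 1) (a : ℕ) (Γ Δ : Multiset (Fml L 0))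
      (ha : Sequent.Fresh a ⟨Γ, Fml.all A ::ₘ Δ⟩) :
      Calc L X [⟨Γ, {A.inst (param a)}⟩] ⟨Γ, Fml.all A ::ₘ Δ⟩
  | exL {X : System} (A : Fml L 1) (a : ℕ) (Γ Δ : Multiset (Fml L 0))
      (ha : Sequent.Fresh a ⟨Fml.ex A ::ₘ Γ, Δ⟩) :
      Calc L X [⟨A.inst (param a) ::ₘ Γ, Δ⟩] ⟨Fml.ex A ::ₘ Γ, Δ⟩
  | exR {X : System} (A : Fml L 1) (t : L.Term (ℕ ⊕ Fin 0)) (Γ Δ : Multiset (Fml L 0)) :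
      Calc L X [⟨Γ, Fml.ex A ::ₘ A.inst t ::ₘ Δ⟩] ⟨Γ, Fml.ex A ::ₘ Δ⟩

/-- Left weakening. -/
inductive LW (L : FirstOrder.Language.{u, v}) : Rule L
  | mk (A : Fml L 0) (Γ Δ : Multiset (Fml L 0)) : LW L [⟨Γ, Δ⟩] ⟨A ::ₘ Γ, Δ⟩

/-- Right weakening. -/
inductive RW (L : FirstOrder.Language.{u, v}) : Rule L
  | mk (A : Fml L 0) (Γ Δ : Multiset (Fml L 0)) : RW L [⟨Γ, Δ⟩] ⟨Γ, A ::ₘ Δ⟩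

/-- Left contraction. -/
inductive LC (L : FirstOrder.Language.{u, v}) : Rule L
  | mk (A : Fml L 0) (Γ Δ : Multiset (Fml L 0)) : LC L [⟨A ::ₘ A ::ₘ Γ, Δ⟩] ⟨A ::ₘ Γ, Δ⟩

/-- Right contraction. -/
inductive RC (L : FirstOrder.Language.{u, v}) : Rule L
  | mk (A : Fml L 0) (Γ Δ : Multiset (Fml L 0)) : RC L [⟨Γ, A ::ₘ A ::ₘ Δ⟩] ⟨Γ, A ::ₘ Δ⟩

/-- Cut with independent contexts. -/
inductive Cut (L : FirstOrder.Language.{u, v}) : Rule L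
  | mk (A : Fml L 0) (Γ Δ Λ Θ : Multiset (Fml L 0)) :
      Cut L [⟨Γ, A ::ₘ Δ⟩, ⟨A ::ₘ Λ, Θ⟩] ⟨Γ + Λ, Δ + Θ⟩

/-- Context-sharing cut. -/
inductive CutCs (L : FirstOrder.Language.{u, v}) : Rule L
  | mk (A : Fml L 0) (Γ Δ : Multiset (Fml L 0)) :
      CutCs L [⟨Γ, A ::ₘ Δ⟩, ⟨A ::ₘ Γ, Δ⟩] ⟨Γ, Δ⟩

/-- All the structural rules together. -/
def Structural (L : FirstOrder.Language.{u, v}) : Rule L := fun ps s =>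
  LW L ps s ∨ RW L ps s ∨ LC L ps s ∨ RC L ps s ∨ Cut L ps s ∨ CutCs L ps s

/-- The calculus `C + C'`, whose rules are those of `C` and those of `C'`. -/
def Rule.add (C C' : Rule L) : Rule L := fun ps s => C ps s ∨ C' ps s

end G3

/-! Eigenvariable conditions are eliminated before any structural argument. The auxiliary calculus
`SDer` works on multisets of signed formulas, and its rules for `∀` on the right and `∃` on the left
have one premiss for every term. Any finitary derivation gives such a family by substituting for the
eigenvariable (`Derivable.sder_subst`). Conversely, the family member at a fresh parameter is the
finitary premiss (`SDer.derivable`). Hence the two calculi derive the same sequents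
(`derivable_iff_sder`), and no renaming is needed inside `SDer`.

Within `SDer` a single induction, `SDer.replace`, replaces a multiset `S` by `R` throughout a
derivation and leaves open only initial sequents and inferences with principal formula in `S`.
Inversion, contraction and both inductions for cut are instances of it. Contraction and cut also use
induction on formula size. Where the formula is invertible, they pass to immediate subformulas or
instances at once, so no derivation heights are needed. Otherwise the occurrence is traced up to the
inferences where it is principal.

In the minimal and intuitionistic systems some right rules drop the succedent. A replacement passes
through them if `S` lies in the succedent, or if `S` and `R` both lie in the antecedent. The cut
argument is arranged to respect this. -/

/-! ### Substitution, occurrence of parameters, and formula size -/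

open FirstOrder.Language in
/-- Substitutions compose. -/
theorem FirstOrder.Language.Term.subst_subst {L : FirstOrder.Language} {α β γ : Type*}
    (t : L.Term α) (σ : α → L.Term β) (τ : β → L.Term γ) :
    (t.subst σ).subst τ = t.subst (fun x => (σ x).subst τ) := by
  induction t with
  | var => rfl
  | func f ts ih => simp [Term.subst, ih]

open FirstOrder.Language in
theorem FirstOrder.Language.Term.relabel_subst {L : FirstOrder.Language} {α β γ : Type*}
    (t : L.Term α) (g : α → β) (τ : β → L.Term γ) :
    (t.relabel g).subst τ = t.subst (fun x => τ (g x)) := by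
  induction t with
  | var => rfl
  | func f ts ih => simp [Term.relabel, Term.subst, ih]

open FirstOrder.Language in
theorem FirstOrder.Language.Term.subst_relabel {L : FirstOrder.Language} {α β γ : Type*}
    (t : L.Term α) (σ : α → L.Term β) (g : β → γ) :
    (t.subst σ).relabel g = t.subst (fun x => (σ x).relabel g) := by
  induction t with
  | var => rfl
  | func f ts ih => simp [Term.relabel, Term.subst, ih]

open FirstOrder.Language in
theorem FirstOrder.Language.Term.subst_var {L : FirstOrder.Language} {α : Type*}
    (t : L.Term α) : t.subst Term.var = t := by
  induction t with
  | var => rfl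
  | func f ts ih => simp [Term.subst, ih]

open FirstOrder.Language in
theorem FirstOrder.Language.Term.subst_congr {L : FirstOrder.Language} {α β : Type*}
    [DecidableEq α] (t : L.Term α) {σ τ : α → L.Term β} (h : ∀ x ∈ t.varFinset, σ x = τ x) :
    t.subst σ = t.subst τ := by
  induction t with
  | var => exact h _ (by simp [Term.varFinset])
  | func f ts ih =>
    simp only [Term.subst, Term.func.injEq, heq_eq_eq, true_and]
    funext i
    exact ih i fun x hx => h x (by
      simp only [Term.varFinset, Finset.mem_biUnion, Finset.mem_univ, true_and]
      exact ⟨i, hx⟩)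

namespace G3

open FirstOrder.Language

universe u v
variable {L : FirstOrder.Language.{u, v}}

theorem liftSubst_comp {n m k : ℕ} (σ : ℕ ⊕ Fin n → L.Term (ℕ ⊕ Fin m))
    (τ : ℕ ⊕ Fin m → L.Term (ℕ ⊕ Fin k)) (x : ℕ ⊕ Fin (n + 1)) :
    (liftSubst σ x).subst (liftSubst τ) = liftSubst (fun y => (σ y).subst τ) x := by
  have key (t : L.Term (ℕ ⊕ Fin m)) : (t.relabel (Sum.map id Fin.succ)).subst (liftSubst τ) =
      (t.subst τ).relabel (Sum.map id Fin.succ) := by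
    rw [Term.relabel_subst, Term.subst_relabel]
    congr 1
    funext x
    rcases x with a | i <;> rfl
  rcases x with a | i
  · exact key _
  · refine Fin.cases rfl (fun i => ?_) i
    exact key _

theorem liftSubst_var {n : ℕ} :
    liftSubst (Term.var : ℕ ⊕ Fin n → L.Term (ℕ ⊕ Fin n)) = Term.var := by
  funext x
  rcases x with a | i
  · rfl
  · exact Fin.cases rfl (fun i => rfl) i

namespace Fml

theorem subst_subst {n m k : ℕ} (A : Fml L n) (σ : ℕ ⊕ Fin n → L.Term (ℕ ⊕ Fin m))
    (τ : ℕ ⊕ Fin m → L.Term (ℕ ⊕ Fin k)) :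
    (A.subst σ).subst τ = A.subst (fun x => (σ x).subst τ) := by
  induction A generalizing m k with
  | rel R ts => simp [subst, Term.subst_subst]
  | bot => rfl
  | and A B ihA ihB => simp [subst, ihA, ihB]
  | or A B ihA ihB => simp [subst, ihA, ihB]
  | imp A B ihA ihB => simp [subst, ihA, ihB]
  | all A ih => simp only [subst, ih, liftSubst_comp]
  | ex A ih => simp only [subst, ih, liftSubst_comp]

theorem subst_var {n : ℕ} (A : Fml L n) : A.subst Term.var = A := by
  induction A with
  | rel R ts => simp [subst, Term.subst_var]
  | bot => rfl
  | and A B ihA ihB => simp [subst, ihA, ihB]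
  | or A B ihA ihB => simp [subst, ihA, ihB]
  | imp A B ihA ihB => simp [subst, ihA, ihB]
  | all A ih => simp [subst, ih, liftSubst_var]
  | ex A ih => simp [subst, ih, liftSubst_var]

theorem subst_congr {n m : ℕ} (A : Fml L n) {σ τ : ℕ ⊕ Fin n → L.Term (ℕ ⊕ Fin m)}
    (hp : ∀ a, A.Occurs a → σ (Sum.inl a) = τ (Sum.inl a))
    (hb : ∀ i, σ (Sum.inr i) = τ (Sum.inr i)) : A.subst σ = A.subst τ := by
  have lift {n m : ℕ} {A : Fml L (n + 1)} {σ τ : ℕ ⊕ Fin n → L.Term (ℕ ⊕ Fin m)}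
      (ih : ∀ {σ' τ' : ℕ ⊕ Fin (n + 1) → L.Term (ℕ ⊕ Fin (m + 1))},
        (∀ a, A.Occurs a → σ' (Sum.inl a) = τ' (Sum.inl a)) →
        (∀ i, σ' (Sum.inr i) = τ' (Sum.inr i)) → A.subst σ' = A.subst τ')
      (hp : ∀ a, A.Occurs a → σ (Sum.inl a) = τ (Sum.inl a))
      (hb : ∀ i, σ (Sum.inr i) = τ (Sum.inr i)) :
      A.subst (liftSubst σ) = A.subst (liftSubst τ) := by
    refine ih (fun a ha => ?_) (fun i => ?_)
    · simp [liftSubst, hp a ha]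
    · exact Fin.cases rfl (fun i => by simp [liftSubst, hb]) i
  induction A generalizing m with
  | rel R ts =>
    simp only [subst, rel.injEq, heq_eq_eq, true_and]
    funext i
    refine Term.subst_congr _ fun x hx => ?_
    rcases x with a | j
    · exact hp a ⟨i, hx⟩
    · exact hb j
  | bot => rfl
  | and A B ihA ihB =>
    simp only [subst]
    rw [ihA (fun a h => hp a (Or.inl h)) hb, ihB (fun a h => hp a (Or.inr h)) hb]
  | or A B ihA ihB =>
    simp only [subst]
    rw [ihA (fun a h => hp a (Or.inl h)) hb, ihB (fun a h => hp a (Or.inr h)) hb]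
  | imp A B ihA ihB =>
    simp only [subst]
    rw [ihA (fun a h => hp a (Or.inl h)) hb, ihB (fun a h => hp a (Or.inr h)) hb]
  | all A ih => exact congrArg all (lift ih hp hb)
  | ex A ih => exact congrArg ex (lift ih hp hb)

theorem inst_subst (A : Fml L 1) (u : L.Term (ℕ ⊕ Fin 0))
    (τ : ℕ ⊕ Fin 0 → L.Term (ℕ ⊕ Fin 0)) :
    (A.inst u).subst τ = (A.subst (liftSubst τ)).inst (u.subst τ) := by
  unfold inst
  rw [subst_subst, subst_subst]
  congr 1
  funext x
  rcases x with a | i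
  · simp only [liftSubst, Sum.elim_inl, Term.relabel_subst, Term.subst]
    -- The shift of bound variables has no effect on `τ (Sum.inl a)`, because `Fin 0` is empty.
    conv_lhs => rw [← Term.subst_var (τ (Sum.inl a))]
    congr 1
    funext y
    rcases y with b | j
    · rfl
    · exact j.elim0
  · obtain rfl : i = 0 := Subsingleton.elim _ _
    rfl

theorem subst_update (A : Fml L 0) {a : ℕ} (ha : ¬ A.Occurs a)
    (σ : ℕ ⊕ Fin 0 → L.Term (ℕ ⊕ Fin 0)) (t : L.Term (ℕ ⊕ Fin 0)) :
    A.subst (Function.update σ (Sum.inl a) t) = A.subst σ :=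
  subst_congr A
    (fun b hb => Function.update_of_ne (by rintro ⟨⟩; exact ha hb) _ _) (fun i => i.elim0)

/-- Turns an eigenvariable premiss into its instance at an arbitrary term, while `σ` acts on all
other parameters. -/
theorem inst_param_subst_update (A : Fml L 1) {a : ℕ} (ha : ¬ A.Occurs a)
    (σ : ℕ ⊕ Fin 0 → L.Term (ℕ ⊕ Fin 0)) (t : L.Term (ℕ ⊕ Fin 0)) :
    (A.inst (param a)).subst (Function.update σ (Sum.inl a) t) =
      (A.subst (liftSubst σ)).inst t := by
  rw [inst_subst]
  congr 1
  · refine subst_congr A (fun b hb => ?_) (fun i => ?_)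
    · have : (Sum.inl b : ℕ ⊕ Fin 0) ≠ Sum.inl a := by rintro ⟨⟩; exact ha hb
      simp only [liftSubst, Sum.elim_inl, Function.update_of_ne this]
    · obtain rfl : i = 0 := Subsingleton.elim _ _
      rfl
  · simp [param, Term.subst]

/-- A bound, unlike a single fresh parameter, can be combined over several formulas by taking
maxima. -/
theorem exists_forall_ge_not_occurs {n : ℕ} (A : Fml L n) : ∃ N, ∀ a ≥ N, ¬ A.Occurs a := by
  have two {P Q : ℕ → Prop} (hP : ∃ N, ∀ a ≥ N, ¬ P a) (hQ : ∃ N, ∀ a ≥ N, ¬ Q a) :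
      ∃ N, ∀ a ≥ N, ¬ (P a ∨ Q a) := by
    obtain ⟨M, hM⟩ := hP
    obtain ⟨N, hN⟩ := hQ
    refine ⟨max M N, fun a ha => ?_⟩
    simp only [not_or]
    exact ⟨hM a (le_of_max_le_left ha), hN a (le_of_max_le_right ha)⟩
  induction A with
  | rel R ts =>
    have hfin : {a : ℕ | ∃ i, Sum.inl a ∈ (ts i).varFinset}.Finite := by
      rw [Set.ofPred_exists]
      exact Set.finite_iUnion fun i =>
        (Finset.finite_toSet (ts i).varFinset).preimage Sum.inl_injective.injOn
    obtain ⟨N, hN⟩ := hfin.bddAbove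
    exact ⟨N + 1, fun a ha h => by have := hN h; omega⟩
  | bot => exact ⟨0, fun a _ h => h⟩
  | and A B ihA ihB => exact two ihA ihB
  | or A B ihA ihB => exact two ihA ihB
  | imp A B ihA ihB => exact two ihA ihB
  | all A ih => exact ih
  | ex A ih => exact ih

/-- The number of logical symbols of a formula. -/
def size : {n : ℕ} → Fml L n → ℕ
  | _, rel _ _ => 0
  | _, bot => 0
  | _, and A B => A.size + B.size + 1
  | _, or A B => A.size + B.size + 1
  | _, imp A B => A.size + B.size + 1
  | _, all A => A.size + 1
  | _, ex A => A.size + 1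

theorem size_subst {n m : ℕ} (A : Fml L n) (σ : ℕ ⊕ Fin n → L.Term (ℕ ⊕ Fin m)) :
    (A.subst σ).size = A.size := by
  induction A generalizing m <;> simp [subst, size, *]

theorem size_inst (A : Fml L 1) (t : L.Term (ℕ ⊕ Fin 0)) : (A.inst t).size = A.size :=
  size_subst A _

end Fml

theorem exists_forall_ge_not_occurs (Γ : Multiset (Fml L 0)) :
    ∃ N, ∀ a ≥ N, ∀ A ∈ Γ, ¬ A.Occurs a := by
  induction Γ using Multiset.induction with
  | empty => exact ⟨0, by simp⟩
  | cons A Γ ih =>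
    obtain ⟨M, hM⟩ := A.exists_forall_ge_not_occurs
    obtain ⟨N, hN⟩ := ih
    refine ⟨max M N, fun a ha => ?_⟩
    simp only [Multiset.mem_cons, forall_eq_or_imp]
    exact ⟨hM a (le_of_max_le_left ha), hN a (le_of_max_le_right ha)⟩

theorem Sequent.exists_fresh (s : Sequent L) : ∃ a, s.Fresh a := by
  obtain ⟨M, hM⟩ := exists_forall_ge_not_occurs s.ant
  obtain ⟨N, hN⟩ := exists_forall_ge_not_occurs s.suc
  exact ⟨max M N, hM _ (le_max_left _ _), hN _ (le_max_right _ _)⟩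

/-! ### The calculus of signed formulas -/

variable (L) in
/-- Formulas with a sign: `(true, A)` stands for `A` in the antecedent, `(false, A)` for `A` in the
succedent. -/
abbrev SFml := Bool × Fml L 0

/-- The antecedent part of a signed sequent. -/
def antPart (Γ : Multiset (SFml L)) : Multiset (SFml L) := Γ.filter (fun F => F.1 = true)

@[simp] theorem antPart_add (Γ Δ : Multiset (SFml L)) :
    antPart (Γ + Δ) = antPart Γ + antPart Δ := Multiset.filter_add _ _ _

@[simp] theorem antPart_zero : antPart (0 : Multiset (SFml L)) = 0 := rfl

@[simp] theorem antPart_cons_true (A : Fml L 0) (Γ : Multiset (SFml L)) :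
    antPart ((true, A) ::ₘ Γ) = (true, A) ::ₘ antPart Γ := Multiset.filter_cons_of_pos _ rfl

@[simp] theorem antPart_cons_false (A : Fml L 0) (Γ : Multiset (SFml L)) :
    antPart ((false, A) ::ₘ Γ) = antPart Γ := Multiset.filter_cons_of_neg _ (by simp)

@[simp] theorem antPart_singleton_true (A : Fml L 0) :
    antPart {((true, A) : SFml L)} = {(true, A)} := rfl

@[simp] theorem antPart_singleton_false (A : Fml L 0) :
    antPart {((false, A) : SFml L)} = 0 := rfl

@[simp] theorem antPart_antPart (Γ : Multiset (SFml L)) : antPart (antPart Γ) = antPart Γ := by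
  simp [antPart, Multiset.filter_filter]

theorem antPart_le (Γ : Multiset (SFml L)) : antPart Γ ≤ Γ := Multiset.filter_le _ _

/-- The context of a rule that is kept in its premisses; if `j` holds, the succedent is dropped. -/
def ctx (j : Bool) (Γ : Multiset (SFml L)) : Multiset (SFml L) := if j then antPart Γ else Γ

@[simp] theorem ctx_true (Γ : Multiset (SFml L)) : ctx true Γ = antPart Γ := rfl
@[simp] theorem ctx_false (Γ : Multiset (SFml L)) : ctx false Γ = Γ := rfl

theorem ctx_add (j : Bool) (Γ Δ : Multiset (SFml L)) : ctx j (Γ + Δ) = ctx j Γ + ctx j Δ := by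
  cases j <;> simp

/-- The formulas of initial sequents `A, Γ ⇒ Δ, A`. -/
inductive IsAxiomFml : System → Fml L 0 → Prop
  | rel {X : System} {k : ℕ} (R : L.Relations k) (ts : Fin k → L.Term (ℕ ⊕ Fin 0)) :
      IsAxiomFml X (Fml.rel R ts)
  | bot : IsAxiomFml .m Fml.bot

/-- Rules in terms of signed formulas: `SRule X P j prems` says that there is a rule with principal
formula `P` and with the sets `prems` of active formulas in its premisses; `j` tells whether the
succedent is dropped from the context.  An eigenvariable is replaced by a family of premisses, one
for each term. -/
inductive SRule : System → SFml L → Bool → Set (Multiset (SFml L)) → Prop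
  | botL {X : System} (hX : X ≠ .m) : SRule X (true, Fml.bot) false ∅
  | andL {X : System} (A B : Fml L 0) :
      SRule X (true, Fml.and A B) false {{(true, A), (true, B)}}
  | andR {X : System} (A B : Fml L 0) :
      SRule X (false, Fml.and A B) false {{(false, A)}, {(false, B)}}
  | orL {X : System} (A B : Fml L 0) :
      SRule X (true, Fml.or A B) false {{(true, A)}, {(true, B)}}
  | orR {X : System} (A B : Fml L 0) :
      SRule X (false, Fml.or A B) false {{(false, A), (false, B)}}
  | impLc (A B : Fml L 0) : SRule .c (true, Fml.imp A B) false {{(false, A)}, {(true, B)}}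
  | impRc (A B : Fml L 0) : SRule .c (false, Fml.imp A B) false {{(true, A), (false, B)}}
  | impLi {X : System} (hX : X ≠ .c) (A B : Fml L 0) :
      SRule X (true, Fml.imp A B) false {{(true, Fml.imp A B), (false, A)}, {(true, B)}}
  | impRi {X : System} (hX : X ≠ .c) (A B : Fml L 0) :
      SRule X (false, Fml.imp A B) true {{(true, A), (false, B)}}
  | allL {X : System} (A : Fml L 1) (t : L.Term (ℕ ⊕ Fin 0)) :
      SRule X (true, Fml.all A) false {{(true, A.inst t), (true, Fml.all A)}}
  | allRc (A : Fml L 1) :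
      SRule .c (false, Fml.all A) false (Set.range fun t => {(false, A.inst t)})
  | allRi {X : System} (hX : X ≠ .c) (A : Fml L 1) :
      SRule X (false, Fml.all A) true (Set.range fun t => {(false, A.inst t)})
  | exL {X : System} (A : Fml L 1) :
      SRule X (true, Fml.ex A) false (Set.range fun t => {(true, A.inst t)})
  | exR {X : System} (A : Fml L 1) (t : L.Term (ℕ ⊕ Fin 0)) :
      SRule X (false, Fml.ex A) false {{(false, Fml.ex A), (false, A.inst t)}}

/-- Derivability of signed sequents. -/
inductive SDer (X : System) : Multiset (SFml L) → Prop
  | ax {A : Fml L 0} {Γ : Multiset (SFml L)} (hA : IsAxiomFml X A) (hl : (true, A) ∈ Γ)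
      (hr : (false, A) ∈ Γ) : SDer X Γ
  | rule {P : SFml L} {j : Bool} {prems : Set (Multiset (SFml L))} (h : SRule X P j prems)
      (Γ : Multiset (SFml L)) (hp : ∀ M ∈ prems, SDer X (M + ctx j Γ)) : SDer X ({P} + Γ)

theorem pair_eq_add {α : Type*} (a b : α) : ({a, b} : Multiset α) = {a} + {b} := rfl

theorem SDer.cast {X : System} {Γ Δ : Multiset (SFml L)} (h : SDer X Γ) (e : Γ = Δ) :
    SDer X Δ := e ▸ h

variable {X : System}

/-- There is no eigenvariable that `Δ` could violate; a rule that drops the succedent merely leaves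
`antPart Δ` in its premisses. -/
theorem SDer.weaken_add {Γ : Multiset (SFml L)} (h : SDer X Γ) (Δ : Multiset (SFml L)) :
    SDer X (Γ + Δ) := by
  induction h generalizing Δ with
  | ax hA hl hr =>
    exact .ax hA (Multiset.mem_add.2 (Or.inl hl)) (Multiset.mem_add.2 (Or.inl hr))
  | rule h Γ hp ih =>
    rw [add_assoc]
    refine .rule h _ fun M hM => ?_
    rw [ctx_add, ← add_assoc]
    exact ih M hM _

theorem SDer.mono {Γ Δ : Multiset (SFml L)} (h : SDer X Γ) (hle : Γ ≤ Δ) : SDer X Δ := by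
  obtain ⟨Λ, rfl⟩ := Multiset.le_iff_exists_add.1 hle
  exact h.weaken_add Λ

/-! ### Replacement in derivations and inversion -/

/-- Replacement of `S` by `R` in a derivation, if this is possible in initial sequents and in
inferences with a principal formula in `S`. -/
theorem SDer.replace {S R : Multiset (SFml L)}
    (hctx : X = .c ∨ antPart S = 0 ∨ (antPart S = S ∧ antPart R = R))
    (hax : ∀ A Γ, IsAxiomFml X A → (true, A) ∈ S + Γ → (false, A) ∈ S + Γ → SDer X (R + Γ))
    (hrule : ∀ P S', S = {P} + S' → ∀ j prems, SRule X P j prems → ∀ Γ,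
      (∀ M ∈ prems, SDer X (M + ctx j (S' + Γ))) →
      (∀ M ∈ prems, ∀ Γ', M + ctx j (S' + Γ) = S + Γ' → SDer X (R + Γ')) → SDer X (R + Γ))
    {Γ : Multiset (SFml L)} (h : SDer X (S + Γ)) : SDer X (R + Γ) := by
  generalize hN : S + Γ = N at h
  induction h generalizing Γ with
  | ax hA hl hr => subst hN; exact hax _ _ hA hl hr
  | @rule P j prems h Γ₀ hp ih =>
    have hP : P ∈ S + Γ := by rw [hN]; simp
    rcases Multiset.mem_add.1 hP with hS | hG
    · obtain ⟨S', rfl⟩ := Multiset.exists_cons_of_mem hS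
      obtain rfl : S' + Γ = Γ₀ := by
        rw [← Multiset.singleton_add, add_assoc] at hN
        exact add_left_cancel hN
      exact hrule P S' (Multiset.singleton_add _ _).symm j prems h Γ hp
        fun M hM Γ' e => ih M hM e.symm
    · obtain ⟨Γ₁, rfl⟩ := Multiset.exists_cons_of_mem hG
      obtain rfl : S + Γ₁ = Γ₀ := by
        rw [← Multiset.singleton_add, add_left_comm] at hN
        exact add_left_cancel hN
      rw [← Multiset.singleton_add, add_left_comm]
      refine .rule h _ fun M hM => ?_
      have ihM := fun Γ' e => ih M hM (Γ := Γ') e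
      cases j with
      | false =>
        exact (ihM (M + Γ₁) (by simp [add_left_comm])).cast (by simp [add_left_comm])
      | true =>
        -- The succedent is dropped. Classically there is no such rule. If `S` is in the succedent
        -- it has vanished from the premiss, and weakening suffices; if `S` and `R` are in the
        -- antecedent both survive, and the induction hypothesis applies.
        rcases hctx with rfl | h0 | ⟨h1, h2⟩
        · cases h <;> contradiction
        · refine (hp M hM).mono ?_
          simp [h0]
        · refine (ihM (M + antPart Γ₁) (by simp [h1, add_left_comm])).cast ?_
          simp [h2, add_left_comm]

/-- Inversion: a formula whose rule always has the active formulas `R` in one of its premisses can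
be replaced by `R`. -/
theorem SDer.invert {F : SFml L} {R : Multiset (SFml L)}
    (hctx : X = .c ∨ F.1 = false ∨ antPart R = R) (hax : ¬ IsAxiomFml X F.2)
    (hrule : ∀ j prems, SRule X F j prems → j = false ∧ R ∈ prems)
    {Γ : Multiset (SFml L)} (h : SDer X ({F} + Γ)) : SDer X (R + Γ) := by
  refine SDer.replace (S := {F}) ?_ ?_ ?_ h
  · obtain ⟨b, A⟩ := F
    rcases hctx with hX | hb | hR
    · exact Or.inl hX
    · obtain rfl : b = false := hb
      exact Or.inr (Or.inl rfl)
    · cases b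
      · exact Or.inr (Or.inl rfl)
      · exact Or.inr (Or.inr ⟨rfl, hR⟩)
  · intro A Γ hA hl hr
    have ne (b : Bool) : (b, A) ≠ F := by rintro rfl; exact hax hA
    simp only [Multiset.mem_add, Multiset.mem_singleton, ne, false_or] at hl hr
    exact .ax hA (Multiset.mem_add.2 (Or.inr hl)) (Multiset.mem_add.2 (Or.inr hr))
  · intro P S' hS j prems hr Γ hp _
    obtain ⟨rfl, rfl⟩ : P = F ∧ S' = 0 := by
      rw [Multiset.singleton_add, Multiset.singleton_eq_cons_iff] at hS
      exact ⟨hS.1.symm, hS.2⟩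
    obtain ⟨rfl, hR⟩ := hrule j prems hr
    -- The sequent sought is itself one of the premisses.
    simpa using hp R hR

namespace SDer

variable {Γ : Multiset (SFml L)} {A B : Fml L 0}

theorem and_left_inv (h : SDer X ({(true, A.and B)} + Γ)) :
    SDer X ({(true, A), (true, B)} + Γ) :=
  invert (Or.inr (Or.inr rfl)) (by rintro ⟨⟩) (by rintro _ _ ⟨⟩; simp) h

theorem and_right_inv₁ (h : SDer X ({(false, A.and B)} + Γ)) : SDer X ({(false, A)} + Γ) :=
  invert (Or.inr (Or.inl rfl)) (by rintro ⟨⟩) (by rintro _ _ ⟨⟩; simp) h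

theorem and_right_inv₂ (h : SDer X ({(false, A.and B)} + Γ)) : SDer X ({(false, B)} + Γ) :=
  invert (Or.inr (Or.inl rfl)) (by rintro ⟨⟩) (by rintro _ _ ⟨⟩; simp) h

theorem or_left_inv₁ (h : SDer X ({(true, A.or B)} + Γ)) : SDer X ({(true, A)} + Γ) :=
  invert (Or.inr (Or.inr rfl)) (by rintro ⟨⟩) (by rintro _ _ ⟨⟩; simp) h

theorem or_left_inv₂ (h : SDer X ({(true, A.or B)} + Γ)) : SDer X ({(true, B)} + Γ) :=
  invert (Or.inr (Or.inr rfl)) (by rintro ⟨⟩) (by rintro _ _ ⟨⟩; simp) h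

theorem or_right_inv (h : SDer X ({(false, A.or B)} + Γ)) :
    SDer X ({(false, A), (false, B)} + Γ) :=
  invert (Or.inr (Or.inl rfl)) (by rintro ⟨⟩) (by rintro _ _ ⟨⟩; simp) h

theorem imp_left_inv₂ (h : SDer X ({(true, A.imp B)} + Γ)) : SDer X ({(true, B)} + Γ) :=
  invert (Or.inr (Or.inr rfl)) (by rintro ⟨⟩) (by rintro _ _ ⟨⟩ <;> simp) h

/-- Classical only: the first premiss of `impLi` repeats the implication. -/
theorem imp_left_inv₁ (h : SDer .c ({(true, A.imp B)} + Γ)) : SDer .c ({(false, A)} + Γ) :=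
  invert (Or.inl rfl) (by rintro ⟨⟩) (by rintro _ _ ⟨⟩ <;> simp_all) h

theorem imp_right_inv (h : SDer .c ({(false, A.imp B)} + Γ)) :
    SDer .c ({(true, A), (false, B)} + Γ) :=
  invert (Or.inl rfl) (by rintro ⟨⟩) (by rintro _ _ ⟨⟩ <;> simp_all) h

theorem all_right_inv {A : Fml L 1} (t : L.Term (ℕ ⊕ Fin 0))
    (h : SDer .c ({(false, A.all)} + Γ)) : SDer .c ({(false, A.inst t)} + Γ) :=
  invert (Or.inl rfl) (by rintro ⟨⟩) (by rintro _ _ ⟨⟩ <;> simp_all) h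

theorem ex_left_inv {A : Fml L 1} (t : L.Term (ℕ ⊕ Fin 0))
    (h : SDer X ({(true, A.ex)} + Γ)) : SDer X ({(true, A.inst t)} + Γ) :=
  invert (Or.inr (Or.inr rfl)) (by rintro ⟨⟩) (by rintro _ _ ⟨⟩; simp) h

end SDer

/-! ### The logical rules in usable form, and contraction -/

namespace SDer

variable {Γ Δ : Multiset (SFml L)} {A B : Fml L 0}

theorem and_left (h : SDer X ({(true, A), (true, B)} + Γ)) : SDer X ({(true, A.and B)} + Γ) :=
  .rule (.andL A B) _ (by simpa using h)

theorem and_right (h₁ : SDer X ({(false, A)} + Γ)) (h₂ : SDer X ({(false, B)} + Γ)) :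
    SDer X ({(false, A.and B)} + Γ) :=
  .rule (.andR A B) _ (by simpa using ⟨h₁, h₂⟩)

theorem or_left (h₁ : SDer X ({(true, A)} + Γ)) (h₂ : SDer X ({(true, B)} + Γ)) :
    SDer X ({(true, A.or B)} + Γ) :=
  .rule (.orL A B) _ (by simpa using ⟨h₁, h₂⟩)

theorem or_right (h : SDer X ({(false, A), (false, B)} + Γ)) : SDer X ({(false, A.or B)} + Γ) :=
  .rule (.orR A B) _ (by simpa using h)

theorem imp_left_c (h₁ : SDer .c ({(false, A)} + Γ)) (h₂ : SDer .c ({(true, B)} + Γ)) :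
    SDer .c ({(true, A.imp B)} + Γ) :=
  .rule (.impLc A B) _ (by simpa using ⟨h₁, h₂⟩)

theorem imp_left (hX : X ≠ .c) (h₁ : SDer X ({(true, A.imp B), (false, A)} + Γ))
    (h₂ : SDer X ({(true, B)} + Γ)) : SDer X ({(true, A.imp B)} + Γ) :=
  .rule (.impLi hX A B) _ (by simpa using ⟨by simpa using h₁, h₂⟩)

theorem imp_right_c (h : SDer .c ({(true, A), (false, B)} + Γ)) :
    SDer .c ({(false, A.imp B)} + Γ) :=
  .rule (.impRc A B) _ (by simpa using h)

theorem imp_right (hX : X ≠ .c) (h : SDer X ({(true, A), (false, B)} + antPart Γ)) :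
    SDer X ({(false, A.imp B)} + Γ) :=
  .rule (.impRi hX A B) _ (by simpa using h)

theorem all_left {A : Fml L 1} (t : L.Term (ℕ ⊕ Fin 0))
    (h : SDer X ({(true, A.inst t), (true, A.all)} + Γ)) : SDer X ({(true, A.all)} + Γ) :=
  .rule (.allL A t) _ (by simpa using h)

theorem all_right_c {A : Fml L 1} (h : ∀ t, SDer .c ({(false, A.inst t)} + Γ)) :
    SDer .c ({(false, A.all)} + Γ) :=
  .rule (.allRc A) _ (by simpa using h)

theorem all_right (hX : X ≠ .c) {A : Fml L 1}
    (h : ∀ t, SDer X ({(false, A.inst t)} + antPart Γ)) : SDer X ({(false, A.all)} + Γ) :=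
  .rule (.allRi hX A) _ (by simpa using h)

theorem ex_left {A : Fml L 1} (h : ∀ t, SDer X ({(true, A.inst t)} + Γ)) :
    SDer X ({(true, A.ex)} + Γ) :=
  .rule (.exL A) _ (by simpa using h)

theorem ex_right {A : Fml L 1} (t : L.Term (ℕ ⊕ Fin 0))
    (h : SDer X ({(false, A.ex), (false, A.inst t)} + Γ)) : SDer X ({(false, A.ex)} + Γ) :=
  .rule (.exR A t) _ (by simpa using h)

/-- Contraction of `F`, if this is possible when `F` is principal. -/
theorem contract_of_principal {F : SFml L}
    (hrule : ∀ j prems, SRule X F j prems → ∀ Γ,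
      (∀ M ∈ prems, SDer X (M + ctx j ({F} + Γ))) →
      (∀ M ∈ prems, ∀ Γ', M + ctx j ({F} + Γ) = {F} + {F} + Γ' → SDer X ({F} + Γ')) →
      SDer X ({F} + Γ))
    (h : SDer X ({F} + {F} + Γ)) : SDer X ({F} + Γ) := by
  refine SDer.replace (S := {F} + {F}) ?_ ?_ ?_ h
  · obtain ⟨b, A⟩ := F
    cases b <;> simp
  · intro A Γ hA hl hr
    refine .ax hA ?_ ?_ <;> simp_all
  · intro P S' hS j prems hr Γ hp ih
    obtain ⟨rfl, rfl⟩ : F = P ∧ S' = {F} := by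
      have hF : P ∈ ({F} + {F} : Multiset (SFml L)) := by rw [hS]; simp
      obtain rfl : P = F := by simpa using hF
      exact ⟨rfl, (add_left_cancel hS).symm⟩
    exact hrule j prems hr Γ hp ih

/-- Contraction is admissible. -/
theorem contract_singleton (A : Fml L 0) (b : Bool) {Γ : Multiset (SFml L)}
    (h : SDer X ({(b, A)} + {(b, A)} + Γ)) : SDer X ({(b, A)} + Γ) := by
  induction hn : A.size using Nat.strong_induction_on generalizing A b Γ with
  | _ n ih =>
  subst hn
  have ih (B : Fml L 0) (hB : B.size < A.size) (b : Bool) {Γ Δ : Multiset (SFml L)}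
      (h : SDer X Δ) (e : Δ = {(b, B)} + {(b, B)} + Γ) : SDer X ({(b, B)} + Γ) :=
    ih _ hB B b (h.cast e) rfl
  cases A with
  -- Atomic formulas are never principal in a rule, so only initial sequents matter.
  | rel R ts => exact contract_of_principal (by rintro _ _ ⟨⟩) h
  | bot =>
    refine contract_of_principal ?_ h
    rintro _ _ ⟨⟩ Γ - -
    exact .rule (.botL (by assumption)) _ (by simp)
  | and A B =>
    have hA : A.size < (A.and B).size := by simp only [Fml.size]; omega
    have hB : B.size < (A.and B).size := by simp only [Fml.size]; omega
    rw [add_assoc] at h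
    cases b with
    | true =>
      -- Both copies are inverted, the smaller formulas are contracted, and the rule is applied
      -- once.
      have h := and_left_inv (h.and_left_inv.cast (add_left_comm _ _ _))
      refine and_left ((ih A hA true (Γ := {(true, B)} + Γ) (ih B hB true h
        (Γ := {(true, A)} + {(true, A)} + Γ) ?_) ?_).cast ?_) <;>
      · try simp only [pair_eq_add]
        abel
    | false =>
      have h₁ := and_right_inv₁ (h.and_right_inv₁.cast (add_left_comm _ _ _))
      have h₂ := and_right_inv₂ (h.and_right_inv₂.cast (add_left_comm _ _ _))
      exact and_right (ih A hA false h₁ (add_assoc _ _ _).symm)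
        (ih B hB false h₂ (add_assoc _ _ _).symm)
  | or A B =>
    have hA : A.size < (A.or B).size := by simp only [Fml.size]; omega
    have hB : B.size < (A.or B).size := by simp only [Fml.size]; omega
    rw [add_assoc] at h
    cases b with
    | false =>
      have h := or_right_inv (h.or_right_inv.cast (add_left_comm _ _ _))
      refine or_right ((ih A hA false (Γ := {(false, B)} + Γ) (ih B hB false h
        (Γ := {(false, A)} + {(false, A)} + Γ) ?_) ?_).cast ?_) <;>
      · try simp only [pair_eq_add]
        abel
    | true =>
      have h₁ := or_left_inv₁ (h.or_left_inv₁.cast (add_left_comm _ _ _))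
      have h₂ := or_left_inv₂ (h.or_left_inv₂.cast (add_left_comm _ _ _))
      exact or_left (ih A hA true h₁ (add_assoc _ _ _).symm)
        (ih B hB true h₂ (add_assoc _ _ _).symm)
  | imp A B =>
    have hA : A.size < (A.imp B).size := by simp only [Fml.size]; omega
    have hB : B.size < (A.imp B).size := by simp only [Fml.size]; omega
    by_cases hX : X = .c
    · subst hX
      rw [add_assoc] at h
      cases b with
      | false =>
        have h := imp_right_inv (h.imp_right_inv.cast (add_left_comm _ _ _))
        refine imp_right_c ((ih A hA true (Γ := {(false, B)} + Γ) (ih B hB false h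
          (Γ := {(true, A)} + {(true, A)} + Γ) ?_) ?_).cast ?_) <;>
        · try simp only [pair_eq_add]
          abel
      | true =>
        have h₁ := imp_left_inv₁ (h.imp_left_inv₁.cast (add_left_comm _ _ _))
        have h₂ := imp_left_inv₂ (h.imp_left_inv₂.cast (add_left_comm _ _ _))
        exact imp_left_c (ih A hA false h₁ (add_assoc _ _ _).symm)
          (ih B hB true h₂ (add_assoc _ _ _).symm)
    · refine contract_of_principal ?_ h
      rintro _ _ hr Γ hp hc
      cases hr
      case impLc => exact absurd rfl hX
      case impRc => exact absurd rfl hX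
      case impLi =>
        -- The first premiss still contains both copies of the implication, so the induction on the
        -- derivation applies. In the second, the remaining copy is inverted to `B` and `B` is
        -- contracted.
        refine imp_left hX ((hc _ (Set.mem_insert _ _) ({(false, A)} + Γ) ?_).cast ?_) ?_
        · simp only [pair_eq_add, ctx_false]; abel
        · simp only [pair_eq_add]; abel
        · have h₂ := hp _ (Set.mem_insert_of_mem _ rfl)
          exact ih B hB true (imp_left_inv₂ (h₂.cast (add_left_comm _ _ _)))
            (add_assoc _ _ _).symm
      case impRi =>
        -- The second copy was dropped with the succedent.
        exact imp_right hX ((hp _ rfl).cast (by simp))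
  | all A =>
    have hA (t) : (A.inst t).size < A.all.size := by simp only [Fml.size, Fml.size_inst]; omega
    by_cases hX : X = .c ∧ b = false
    · obtain ⟨rfl, rfl⟩ := hX
      rw [add_assoc] at h
      exact all_right_c fun t => ih _ (hA t) false
        (all_right_inv t ((h.all_right_inv t).cast (add_left_comm _ _ _))) (add_assoc _ _ _).symm
    · refine contract_of_principal ?_ h
      rintro _ _ hr Γ hp hc
      cases hr
      case allRc => exact absurd ⟨rfl, rfl⟩ hX
      case allRi =>
        exact all_right (by assumption) fun t => (hp _ ⟨t, rfl⟩).cast (by simp)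
      case allL t =>
        refine all_left t ((hc _ rfl ({(true, A.inst t)} + Γ) ?_).cast ?_)
        · simp only [pair_eq_add, ctx_false]; abel
        · simp only [pair_eq_add]; abel
  | ex A =>
    have hA (t) : (A.inst t).size < A.ex.size := by simp only [Fml.size, Fml.size_inst]; omega
    cases b with
    | true =>
      rw [add_assoc] at h
      exact ex_left fun t => ih _ (hA t) true
        (ex_left_inv t ((h.ex_left_inv t).cast (add_left_comm _ _ _))) (add_assoc _ _ _).symm
    | false =>
      refine contract_of_principal ?_ h
      rintro _ _ ⟨⟩ Γ hp hc
      rename_i t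
      refine ex_right t ((hc _ rfl ({(false, A.inst t)} + Γ) ?_).cast ?_)
      · simp only [pair_eq_add, ctx_false]; abel
      · simp only [pair_eq_add]; abel

theorem contract (Δ : Multiset (SFml L)) (h : SDer X (Δ + Δ + Γ)) : SDer X (Δ + Γ) := by
  induction Δ using Multiset.induction generalizing Γ with
  | empty => simpa using h
  | cons F Δ ih =>
    rw [← Multiset.singleton_add] at h ⊢
    have h₁ : SDer X (Δ + ({F} + {F} + Γ)) := ih (h.cast (by abel))
    exact (contract_singleton F.2 F.1 (h₁.cast (add_left_comm _ _ _))).cast (by abel)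

/-! ### Cut -/

/-- Induction on the derivation of the left premiss of a cut. -/
theorem cut_of_principal_left {C : Fml L 0} {Λ : Multiset (SFml L)}
    (h₂ : SDer X ({(true, C)} + Λ))
    (hrule : ∀ j prems, SRule X (false, C) j prems → ∀ Γ,
      (∀ M ∈ prems, SDer X (M + ctx j Γ)) →
      (∀ M ∈ prems, ∀ Γ', M + ctx j Γ = {(false, C)} + Γ' → SDer X (Λ + Γ')) → SDer X (Λ + Γ))
    (h₁ : SDer X ({(false, C)} + Γ)) : SDer X (Λ + Γ) := by
  refine SDer.replace (S := {(false, C)}) (Or.inr (Or.inl rfl)) ?_ ?_ h₁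
  · intro A Γ hA hl hr
    replace hl : (true, A) ∈ Γ := by simpa using hl
    by_cases e : A = C
    · subst e
      -- The cut formula also occurs in the antecedent, so the right premiss of the cut, weakened,
      -- is the conclusion.
      obtain ⟨Γ', rfl⟩ := Multiset.exists_cons_of_mem hl
      refine (h₂.weaken_add Γ').cast ?_
      rw [← Multiset.singleton_add]
      abel
    · replace hr : (false, A) ∈ Γ := by simpa [e] using hr
      exact .ax hA (Multiset.mem_add.2 (Or.inr hl)) (Multiset.mem_add.2 (Or.inr hr))
  · intro P S' hS j prems hr Γ hp ih
    obtain ⟨rfl, rfl⟩ : P = (false, C) ∧ S' = 0 := by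
      rw [Multiset.singleton_add, Multiset.singleton_eq_cons_iff] at hS
      exact ⟨hS.1.symm, hS.2⟩
    rw [zero_add] at hp ih
    exact hrule j prems hr Γ hp ih

/-- Induction on the derivation of the right premiss of a cut. -/
theorem cut_of_principal_right {C : Fml L 0} {Λ : Multiset (SFml L)}
    (hctx : X = .c ∨ antPart Γ = Γ) (hC : ¬ IsAxiomFml X C)
    (hrule : ∀ j prems, SRule X (true, C) j prems → ∀ Λ,
      (∀ M ∈ prems, SDer X (M + ctx j Λ)) →
      (∀ M ∈ prems, ∀ Λ', M + ctx j Λ = {(true, C)} + Λ' → SDer X (Γ + Λ')) → SDer X (Γ + Λ))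
    (h₂ : SDer X ({(true, C)} + Λ)) : SDer X (Γ + Λ) := by
  refine SDer.replace (S := {(true, C)}) (hctx.imp_right fun h => Or.inr ⟨rfl, h⟩) ?_ ?_ h₂
  · intro A Λ hA hl hr
    have e : A ≠ C := by rintro rfl; exact hC hA
    refine .ax hA (Multiset.mem_add.2 (Or.inr ?_)) (Multiset.mem_add.2 (Or.inr ?_))
    · simpa [e] using hl
    · simpa using hr
  · intro P S' hS j prems hr Γ hp ih
    obtain ⟨rfl, rfl⟩ : P = (true, C) ∧ S' = 0 := by
      rw [Multiset.singleton_add, Multiset.singleton_eq_cons_iff] at hS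
      exact ⟨hS.1.symm, hS.2⟩
    rw [zero_add] at hp ih
    exact hrule j prems hr Γ hp ih

/-- Cut is admissible. -/
theorem cut (C : Fml L 0) {Γ Λ : Multiset (SFml L)} (h₁ : SDer X ({(false, C)} + Γ))
    (h₂ : SDer X ({(true, C)} + Λ)) : SDer X (Λ + Γ) := by
  induction hn : C.size using Nat.strong_induction_on generalizing C Γ Λ with
  | _ n ih =>
  subst hn
  have ih (B : Fml L 0) (hB : B.size < C.size) {Γ Λ Γ' Λ' : Multiset (SFml L)}
      (h₁ : SDer X Γ') (h₂ : SDer X Λ') (e₁ : Γ' = {(false, B)} + Γ)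
      (e₂ : Λ' = {(true, B)} + Λ) : SDer X (Λ + Γ) :=
    ih _ hB B (h₁.cast e₁) (h₂.cast e₂) rfl
  cases C with
  | rel R ts => exact cut_of_principal_left h₂ (by rintro _ _ ⟨⟩) h₁
  -- `⊥` is never principal in a right rule, so the right premiss needs no analysis.
  | bot => exact cut_of_principal_left h₂ (by rintro _ _ ⟨⟩) h₁
  | and A B =>
    have hA : A.size < (A.and B).size := by simp only [Fml.size]; omega
    have hB : B.size < (A.and B).size := by simp only [Fml.size]; omega
    -- Conjunction is invertible on both sides: two cuts on the conjuncts, then contraction of the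
    -- duplicated context.
    have h := ih B hB h₁.and_right_inv₂ (ih A hA h₁.and_right_inv₁ h₂.and_left_inv rfl
      (Λ := {(true, B)} + Λ) (by simp only [pair_eq_add]; abel)) rfl
      (Λ := Λ + Γ) (by abel)
    exact (contract Γ (h.cast (by abel : _ = Γ + Γ + Λ))).cast (add_comm _ _)
  | or A B =>
    have hA : A.size < (A.or B).size := by simp only [Fml.size]; omega
    have hB : B.size < (A.or B).size := by simp only [Fml.size]; omega
    have h := ih B hB (ih A hA h₁.or_right_inv h₂.or_left_inv₁
      (Γ := {(false, B)} + Γ) (by simp only [pair_eq_add]; abel) rfl) h₂.or_left_inv₂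
      (Γ := Λ + Γ) (by abel) rfl
    exact contract Λ (h.cast (by abel))
  | imp A B =>
    have hA : A.size < (A.imp B).size := by simp only [Fml.size]; omega
    have hB : B.size < (A.imp B).size := by simp only [Fml.size]; omega
    by_cases hX : X = .c
    · subst hX
      have h := ih B hB (ih A hA h₂.imp_left_inv₁ h₁.imp_right_inv (Λ := {(false, B)} + Γ) rfl
        (by simp only [pair_eq_add]; abel)) h₂.imp_left_inv₂ (Γ := Λ + Γ) (by abel) rfl
      exact contract Λ (h.cast (by abel))
    · refine cut_of_principal_left h₂ ?_ h₁
      rintro _ _ ⟨⟩ Γ hp -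
      · exact absurd rfl hX
      have h₁ : SDer X ({(true, A), (false, B)} + antPart Γ) := hp _ rfl
      -- The rule introducing the implication has discarded the succedent of `Γ`. What is left is
      -- purely antecedent, which lets it replace the implication throughout the right derivation.
      have h : SDer X (antPart Γ + Λ) := by
        refine cut_of_principal_right (Or.inr (antPart_antPart Γ)) (by rintro ⟨⟩) ?_ h₂
        rintro _ _ ⟨⟩ Λ hp hc
        · exact absurd rfl hX
        have h₃ := hc _ (Set.mem_insert _ _) ({(false, A)} + Λ)
          (by simp only [pair_eq_add, ctx_false]; abel)
        have h₄ : SDer X ({(true, B)} + Λ) := hp _ (Set.mem_insert_of_mem _ rfl)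
        -- In `h₃` the repeated implication is already eliminated; cuts on `A` and then on `B`
        -- remain.
        have h := ih B hB (ih A hA h₃ h₁ (Λ := {(false, B)} + antPart Γ)
          (add_left_comm _ _ _) (by simp only [pair_eq_add]; abel)) h₄
          (Γ := antPart Γ + (antPart Γ + Λ)) (by abel) rfl
        refine contract (antPart Γ) ?_
        exact (contract Λ (h.cast (by abel : _ = Λ + Λ + (antPart Γ + antPart Γ)))).cast (by abel)
      exact (h.cast (add_comm _ _)).mono (add_le_add_right (antPart_le Γ) _)
  | all A =>
    have hA (t) : (A.inst t).size < A.all.size := by simp only [Fml.size, Fml.size_inst]; omega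
    -- All instances on the left are needed, since each `allL` inference on the right may use its
    -- own term. They come from inversion classically, and from the introducing inference otherwise.
    have key {Γ : Multiset (SFml L)} (hctx : X = .c ∨ antPart Γ = Γ)
        (h₁ : ∀ t, SDer X ({(false, A.inst t)} + Γ)) : SDer X (Λ + Γ) := by
      rw [add_comm]
      refine cut_of_principal_right hctx (by rintro ⟨⟩) ?_ h₂
      rintro _ _ ⟨⟩ Λ hp hc
      rename_i t
      have h₃ := hc _ rfl ({(true, A.inst t)} + Λ)
        (by simp only [pair_eq_add, ctx_false]; abel)
      have h := ih _ (hA t) (h₁ t) h₃ rfl (add_left_comm _ _ _)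
      exact contract Γ (h.cast (by abel))
    by_cases hX : X = .c
    · subst hX
      exact key (Or.inl rfl) fun t => h₁.all_right_inv t
    · refine cut_of_principal_left h₂ ?_ h₁
      rintro _ _ ⟨⟩ Γ hp -
      · exact absurd rfl hX
      exact (key (Or.inr (antPart_antPart Γ)) fun t => hp _ ⟨t, rfl⟩).mono
        (add_le_add_right (antPart_le Γ) _)
  | ex A =>
    have hA (t) : (A.inst t).size < A.ex.size := by simp only [Fml.size, Fml.size_inst]; omega
    refine cut_of_principal_left h₂ ?_ h₁
    rintro _ _ ⟨⟩ Γ hp hc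
    rename_i t
    have h₃ := hc _ rfl ({(false, A.inst t)} + Γ)
      (by simp only [pair_eq_add, ctx_false]; abel)
    have h := ih _ (hA t) h₃ (h₂.ex_left_inv t) (add_left_comm _ _ _) rfl
    exact contract Λ (h.cast (by abel))

end SDer

/-! ### Equivalence of the two calculi -/

/-- A sequent as a multiset of signed formulas. -/
def Sequent.signed (s : Sequent L) : Multiset (SFml L) :=
  s.ant.map (Prod.mk true) + s.suc.map (Prod.mk false)

/-- The formulas of sign `b`. -/
def part (b : Bool) (Γ : Multiset (SFml L)) : Multiset (Fml L 0) :=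
  (Γ.filter (fun F => F.1 = b)).map Prod.snd

@[simp] theorem part_add (b : Bool) (Γ Δ : Multiset (SFml L)) :
    part b (Γ + Δ) = part b Γ + part b Δ := by simp [part]

@[simp] theorem part_zero (b : Bool) : part b (0 : Multiset (SFml L)) = 0 := rfl

@[simp] theorem part_cons (b c : Bool) (A : Fml L 0) (Γ : Multiset (SFml L)) :
    part b ((c, A) ::ₘ Γ) = if c = b then A ::ₘ part b Γ else part b Γ := by
  unfold part
  split_ifs with h <;> simp [h]

@[simp] theorem part_singleton (b c : Bool) (A : Fml L 0) :
    part b {((c, A) : SFml L)} = if c = b then {A} else 0 := part_cons b c A 0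

@[simp] theorem part_true_antPart (Γ : Multiset (SFml L)) :
    part true (antPart Γ) = part true Γ := by simp [part, antPart, Multiset.filter_filter]

@[simp] theorem part_false_antPart (Γ : Multiset (SFml L)) :
    part false (antPart Γ) = 0 := by
  simp [part, antPart, Multiset.filter_filter]

theorem mem_part {b : Bool} {Γ : Multiset (SFml L)} {A : Fml L 0} :
    A ∈ part b Γ ↔ (b, A) ∈ Γ := by
  simp [part]

@[simp] theorem part_map (b c : Bool) (Γ : Multiset (Fml L 0)) :
    part b (Γ.map (Prod.mk c)) = if c = b then Γ else 0 := by
  induction Γ using Multiset.induction with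
  | empty => simp
  | cons A Γ ih => rw [Multiset.map_cons, part_cons, ih]; split_ifs <;> rfl

theorem Derivable.of_fresh {s : Sequent L} (h : ∀ a, s.Fresh a → Derivable (Calc L X) s) :
    Derivable (Calc L X) s :=
  s.exists_fresh.elim h

/-- Signed derivability implies derivability. -/
theorem SDer.derivable {Γ : Multiset (SFml L)} (h : SDer X Γ) :
    Derivable (Calc L X) ⟨part true Γ, part false Γ⟩ := by
  induction h with
  | ax hA hl hr =>
    obtain ⟨Γ', hl⟩ := Multiset.exists_cons_of_mem (mem_part.2 hl)
    obtain ⟨Δ', hr⟩ := Multiset.exists_cons_of_mem (mem_part.2 hr)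
    rw [hl, hr]
    cases hA with
    | rel R ts => exact .infer _ _ (.init R ts _ _) (by simp)
    | bot => exact .infer _ _ (.botInit _ _) (by simp)
  | rule h Γ hp ih =>
    clear hp
    cases h <;> simp at ih ⊢
    case botL hX => exact .infer _ _ (.botL hX _ _) (by simp)
    case andL A B => exact .infer _ _ (.andL A B _ _) (by simpa using ih)
    case andR A B => exact .infer _ _ (.andR A B _ _) (by simpa using ih)
    case orL A B => exact .infer _ _ (.orL A B _ _) (by simpa using ih)
    case orR A B => exact .infer _ _ (.orR A B _ _) (by simpa using ih)
    case impLc A B => exact .infer _ _ (.impLc A B _ _) (by simpa using ih)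
    case impRc A B => exact .infer _ _ (.impRc A B _ _) (by simpa using ih)
    case impLi A B hX => exact .infer _ _ (.impLi hX A B _ _) (by simpa using ih)
    case impRi A B hX => exact .infer _ _ (.impRi hX A B _ _) (by simpa using ih)
    case allL A t => exact .infer _ _ (.allL A t _ _) (by simpa using ih)
    case exR A t => exact .infer _ _ (.exR A t _ _) (by simpa using ih)
    case allRc A =>
      -- Of the whole family only the premiss at a fresh parameter is used.
      exact .of_fresh fun a ha => .infer _ _ (.allRc A a _ _ ha) (by simpa using ih (param a))
    case allRi A hX =>
      exact .of_fresh fun a ha => .infer _ _ (.allRi hX A a _ _ ha) (by simpa using ih (param a))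
    case exL A =>
      exact .of_fresh fun a ha => .infer _ _ (.exL A a _ _ ha) (by simpa using ih (param a))

/-- Substitution of terms for the parameters of a multiset of formulas. -/
def substMS (σ : ℕ ⊕ Fin 0 → L.Term (ℕ ⊕ Fin 0)) (Γ : Multiset (Fml L 0)) :
    Multiset (Fml L 0) := Γ.map (fun A => A.subst σ)

@[simp] theorem substMS_cons (σ : ℕ ⊕ Fin 0 → L.Term (ℕ ⊕ Fin 0)) (A : Fml L 0)
    (Γ : Multiset (Fml L 0)) : substMS σ (A ::ₘ Γ) = A.subst σ ::ₘ substMS σ Γ :=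
  Multiset.map_cons _ _ _

@[simp] theorem substMS_singleton (σ : ℕ ⊕ Fin 0 → L.Term (ℕ ⊕ Fin 0)) (A : Fml L 0) :
    substMS σ {A} = {A.subst σ} := rfl

theorem substMS_update {a : ℕ} {Γ : Multiset (Fml L 0)} (ha : ∀ A ∈ Γ, ¬ A.Occurs a)
    (σ : ℕ ⊕ Fin 0 → L.Term (ℕ ⊕ Fin 0)) (t : L.Term (ℕ ⊕ Fin 0)) :
    substMS (Function.update σ (Sum.inl a) t) Γ = substMS σ Γ :=
  Multiset.map_congr rfl fun A hA => A.subst_update (ha A hA) σ t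

@[simp] theorem antPart_signed (Γ Δ : Multiset (Fml L 0)) :
    antPart (Sequent.signed ⟨Γ, Δ⟩) = Sequent.signed ⟨Γ, 0⟩ := by
  simp only [Sequent.signed, antPart, Multiset.filter_add, Multiset.filter_map]
  simp

theorem signed_cons_ant (A : Fml L 0) (Γ Δ : Multiset (Fml L 0)) :
    Sequent.signed ⟨A ::ₘ Γ, Δ⟩ = {(true, A)} + Sequent.signed ⟨Γ, Δ⟩ := by
  simp [Sequent.signed]

theorem signed_cons_suc (A : Fml L 0) (Γ Δ : Multiset (Fml L 0)) :
    Sequent.signed ⟨Γ, A ::ₘ Δ⟩ = {(false, A)} + Sequent.signed ⟨Γ, Δ⟩ := by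
  simp [Sequent.signed]

theorem signed_singleton_suc (A : Fml L 0) (Γ : Multiset (Fml L 0)) :
    Sequent.signed ⟨Γ, {A}⟩ = {(false, A)} + Sequent.signed ⟨Γ, 0⟩ := signed_cons_suc A Γ 0

/-- All substitution instances of a derivable sequent are derivable as signed sequents. -/
theorem Derivable.sder_subst {s : Sequent L} (h : Derivable (Calc L X) s)
    (σ : ℕ ⊕ Fin 0 → L.Term (ℕ ⊕ Fin 0)) :
    SDer X (Sequent.signed ⟨substMS σ s.ant, substMS σ s.suc⟩) := by
  induction h generalizing σ with
  | infer ps s h hps ih =>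
    clear hps
    cases h <;>
      simp only [substMS_cons, substMS_singleton, signed_cons_ant, signed_cons_suc,
        signed_singleton_suc, Fml.subst, List.mem_cons, List.not_mem_nil, or_false,
        forall_eq_or_imp, forall_eq] at ih ⊢
    case init R ts Γ Δ =>
      exact .ax (.rel R fun i => (ts i).subst σ) (by simp) (by simp)
    case botInit => exact .ax .bot (by simp) (by simp)
    case botL Γ hX => exact .rule (.botL hX) _ (by simp)
    case andL => exact .and_left (by rw [pair_eq_add, add_assoc]; exact ih σ)
    case andR => exact .and_right (ih.1 σ) (ih.2 σ)
    case orL => exact .or_left (ih.1 σ) (ih.2 σ)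
    case orR => exact .or_right (by rw [pair_eq_add, add_assoc]; exact ih σ)
    case impLc => exact .imp_left_c (ih.1 σ) (ih.2 σ)
    case impRc => exact .imp_right_c ((ih σ).cast (by rw [pair_eq_add]; abel))
    case impLi hX =>
      exact .imp_left hX ((ih.1 σ).cast (by rw [pair_eq_add]; abel)) (ih.2 σ)
    case impRi hX =>
      exact .imp_right hX ((ih σ).cast (by rw [pair_eq_add, antPart_signed]; abel))
    case allL A t Γ Δ =>
      exact .all_left (t.subst σ) ((ih σ).cast (by rw [pair_eq_add, Fml.inst_subst]; abel))
    case exR A t Γ Δ =>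
      exact .ex_right (t.subst σ) ((ih σ).cast (by rw [pair_eq_add, Fml.inst_subst]; abel))
    case allRc A a Γ Δ ha =>
      -- Sending the eigenvariable to `t` yields the premiss for `t`; by freshness the context sees
      -- only `σ`. This is why the induction is over all `σ`.
      refine .all_right_c fun t => (ih (Function.update σ (Sum.inl a) t)).cast ?_
      have h₁ := (Multiset.forall_mem_cons.1 ha.2)
      rw [Fml.inst_param_subst_update _ h₁.1, substMS_update ha.1, substMS_update h₁.2]
    case allRi A a Γ Δ ha hX =>
      refine .all_right hX fun t => (ih (Function.update σ (Sum.inl a) t)).cast ?_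
      have h₁ := (Multiset.forall_mem_cons.1 ha.2)
      rw [Fml.inst_param_subst_update _ h₁.1, substMS_update ha.1, antPart_signed]
    case exL A a Γ Δ ha =>
      refine .ex_left fun t => (ih (Function.update σ (Sum.inl a) t)).cast ?_
      have h₁ := (Multiset.forall_mem_cons.1 ha.1)
      rw [Fml.inst_param_subst_update _ h₁.1, substMS_update h₁.2, substMS_update ha.2]

theorem derivable_iff_sder {s : Sequent L} : Derivable (Calc L X) s ↔ SDer X s.signed := by
  refine ⟨fun h => ?_, fun h => ?_⟩
  · simpa [substMS, Fml.subst_var] using h.sder_subst Term.var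
  · simpa [Sequent.signed] using h.derivable

/-! ### Admissibility of the structural rules -/

theorem admissible_LW : Admissible (LW L) (Calc L X) := by
  rintro _ _ ⟨A, Γ, Δ⟩ h
  simp only [List.mem_singleton, forall_eq, derivable_iff_sder, signed_cons_ant] at h ⊢
  exact h.mono (Multiset.le_add_left _ _)

theorem admissible_RW : Admissible (RW L) (Calc L X) := by
  rintro _ _ ⟨A, Γ, Δ⟩ h
  simp only [List.mem_singleton, forall_eq, derivable_iff_sder, signed_cons_suc] at h ⊢
  exact h.mono (Multiset.le_add_left _ _)

theorem admissible_LC : Admissible (LC L) (Calc L X) := by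
  rintro _ _ ⟨A, Γ, Δ⟩ h
  simp only [List.mem_singleton, forall_eq, derivable_iff_sder, signed_cons_ant] at h ⊢
  exact SDer.contract _ (h.cast (add_assoc _ _ _).symm)

theorem admissible_RC : Admissible (RC L) (Calc L X) := by
  rintro _ _ ⟨A, Γ, Δ⟩ h
  simp only [List.mem_singleton, forall_eq, derivable_iff_sder, signed_cons_suc] at h ⊢
  exact SDer.contract _ (h.cast (add_assoc _ _ _).symm)

theorem admissible_Cut : Admissible (Cut L) (Calc L X) := by
  rintro _ _ ⟨A, Γ, Δ, Λ, Θ⟩ h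
  simp only [List.mem_cons, List.not_mem_nil, or_false, forall_eq_or_imp, forall_eq,
    derivable_iff_sder, signed_cons_suc, signed_cons_ant] at h ⊢
  refine (h.1.cut A h.2).cast ?_
  simp only [Sequent.signed, Multiset.map_add]
  abel

theorem admissible_CutCs : Admissible (CutCs L) (Calc L X) := by
  rintro _ _ ⟨A, Γ, Δ⟩ h
  simp only [List.mem_cons, List.not_mem_nil, or_false, forall_eq_or_imp, forall_eq,
    derivable_iff_sder, signed_cons_suc, signed_cons_ant] at h ⊢
  -- The cut leaves two copies of the whole context, which are contracted together.
  have := SDer.contract (Γ := 0) _ ((h.1.cut A h.2).cast (add_zero _).symm)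
  rwa [add_zero] at this

theorem admissible_structural : Admissible (Structural L) (Calc L X) := by
  rintro ps s (h | h | h | h | h | h)
  · exact admissible_LW ps s h
  · exact admissible_RW ps s h
  · exact admissible_LC ps s h
  · exact admissible_RC ps s h
  · exact admissible_Cut ps s h
  · exact admissible_CutCs ps s h

/-- Adding an admissible rule does not change the derivable sequents. -/
theorem Admissible.derivable_of_add {r C : Rule L} (hr : Admissible r C) {s : Sequent L}
    (h : Derivable (C.add r) s) : Derivable C s := by
  induction h with
  | infer ps s h hps ih =>
    rcases h with h | h
    · exact .infer ps s h ih
    · exact hr ps s h ih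

end G3

theorem mainTheorem3 (L : FirstOrder.Language) (X : G3.System) :
    (G3.Admissible (G3.LW L) (G3.Calc L X) ∧ G3.Admissible (G3.RW L) (G3.Calc L X)) ∧
    (G3.Admissible (G3.LC L) (G3.Calc L X) ∧ G3.Admissible (G3.RC L) (G3.Calc L X)) ∧
    (G3.Admissible (G3.Cut L) (G3.Calc L X) ∧ G3.Admissible (G3.CutCs L) (G3.Calc L X)) ∧
    (∀ s : G3.Sequent L, G3.Derivable (G3.Rule.add (G3.Calc L X) (G3.Structural L)) s →
      G3.Derivable (G3.Calc L X) s) :=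

  ⟨⟨G3.admissible_LW, G3.admissible_RW⟩, ⟨G3.admissible_LC, G3.admissible_RC⟩,
    ⟨G3.admissible_Cut, G3.admissible_CutCs⟩,
    fun _ => G3.admissible_structural.derivable_of_add⟩
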